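/- Throughout, rings are commutative. Let $B$ be an algebra over a ring $A$. An element $\theta\in B$ is a monogenerator of $B/A$ if $B=A[\theta]$, and $B/A$ is monogenic if it has a monogenerator. A twisted monogenerator of $B/A$ consists of 1. a Zariski open cover $\operatorname{Spec} A=\bigcup_i D(f_i)$ with $f_i\in A$, 2. for each $i$ a monogenerator $\theta_i\in B[f_i^{-1}]$ of $B[f_i^{-1}]$ over $A[f_i^{-1}]$, and 3. for all $i,j$ a unit $a_{ij}\in A[f_i^{-1},f_j^{-1}]^{*}$ such that $a_{ij}\theta_j=\theta_i$ in $B[f_i^{-1},f_j^{-1}]$ for all $i,j$, and $a_{ij}a_{jk}=a_{ik}$ in $A[f_i^{-1},f_j^{-1},f_k^{-1}]$ for all $i,j,k$. The extension $B/A$ is twisted monogenic if it has a twisted monogenerator. **Theorem.** Let $K$ be a number field with ring of integers $\mathbb Z_K$. Then $K$ has class number one if and only if, for every extension of number fields $L/K$ such that the extension of rings of integers $\mathbb Z_L/\mathbb Z_K$ is twisted monogenic, $\mathbb Z_L/\mathbb Z_K$ is monogenic. -/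

import Mathlib

open scoped NumberField TensorProduct

universe u v

section TwistedMonogenicity

variable (A : Type u) [CommRing A] (B : Type v) [CommRing B] [Algebra A B]

/-- `θ` is a monogenerator of the `A`-algebra `B`: `B = A[θ]`. -/
def IsMonogenerator {B : Type v} [CommRing B] [Algebra A B] (θ : B) : Prop :=
  Algebra.adjoin A {θ} = ⊤

/-- `B` is monogenic over `A`: `B = A[θ]` for some `θ ∈ B`. -/
def IsMonogenic : Prop :=
  ∃ θ : B, IsMonogenerator A θ

variable {A}

/-- The canonical `A`-algebra map `A[1/f] → A[1/g]` for `f ∣ g`, i.e. the restriction of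
functions from `D(f)` to `D(g) ⊆ D(f)`. -/
noncomputable def awayRes {f g : A} (h : f ∣ g) :
    Localization.Away f →ₐ[A] Localization.Away g :=
  IsLocalization.liftAlgHom (M := Submonoid.powers f)
    (f := Algebra.ofId A (Localization.Away g)) (by
      rintro ⟨_, n, rfl⟩
      rw [map_pow]
      exact (isUnit_of_dvd_unit (map_dvd (algebraMap A (Localization.Away g)) h)
        (IsLocalization.Away.algebraMap_isUnit g)).pow n)

/-- The localization `B[1/f]` of the `A`-algebra `B` at (the image of) `f ∈ A`, as an algebra
over `A[1/f]`, in the form `A[1/f] ⊗ B`. -/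
abbrev AwayAlg (f : A) : Type (max u v) :=
  Localization.Away f ⊗[A] B

/-- The canonical map `B[1/f] → B[1/g]` for `f ∣ g`. -/
noncomputable def awayAlgRes {f g : A} (h : f ∣ g) : AwayAlg B f →ₐ[A] AwayAlg B g :=
  Algebra.TensorProduct.map (awayRes h) (AlgHom.id A B)

variable (A)

/-- A (`𝔾ₘ`-)twisted monogenerator of `B / A`, on a cover indexed by `ι`: a cover of `Spec A` by
basic open sets `D(fᵢ)`, monogenerators `θᵢ` of `B[1/fᵢ]` over `A[1/fᵢ]`, and units `aᵢⱼ` of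
`A[1/fᵢ, 1/fⱼ]` with `aᵢⱼ θⱼ = θᵢ` in `B[1/fᵢ, 1/fⱼ]` and `aᵢⱼ aⱼₖ = aᵢₖ` in
`A[1/fᵢ, 1/fⱼ, 1/fₖ]`. -/
structure TwistedMonogenerator (ι : Type u) where
  f : ι → A
  cover : ⨆ i, PrimeSpectrum.basicOpen (f i) = ⊤
  θ : ∀ i, AwayAlg B (f i)
  isMonogenerator : ∀ i, IsMonogenerator (Localization.Away (f i)) (θ i)
  a : ∀ i j, (Localization.Away (f i * f j))ˣ
  smul_eq : ∀ i j,
    (a i j : Localization.Away (f i * f j)) •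
        awayAlgRes B (Dvd.intro_left (f i) rfl : f j ∣ f i * f j) (θ j) =
      awayAlgRes B (Dvd.intro (f j) rfl : f i ∣ f i * f j) (θ i)
  cocycle : ∀ i j k,
    awayRes (Dvd.intro (f k) rfl : f i * f j ∣ f i * f j * f k) (a i j) *
        awayRes (Dvd.intro_left (f i) (mul_assoc _ _ _).symm : f j * f k ∣ f i * f j * f k)
          (a j k) =
      awayRes (Dvd.intro (f j) (mul_right_comm _ _ _) : f i * f k ∣ f i * f j * f k) (a i k)

/-- `B / A` is twisted monogenic: it has a `𝔾ₘ`-twisted monogenerator on some cover. -/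
def IsTwistedMonogenic : Prop :=
  ∃ ι : Type u, Nonempty (TwistedMonogenerator A B ι)

end TwistedMonogenicity

/-! Write A = `𝓞 K`. The units of a twisted monogenerator are a cocycle defining a line bundle on
Spec A. Over a PID this bundle is trivial, so the local monogenerators can be rescaled by units to
one common element of L. That element lies in `𝓞 L` and generates it, since both claims are local on
Spec A (`IsTwistedMonogenic.isMonogenic`).

Conversely, let d = 1 + 4e with (d) = J²S, S squarefree, and ω = (d + √d)/2. The integral elements
of K(√d) are A ⊕ J⁻¹ω (`isIntegral_quadraticAlgebra_iff`). Local generators of J⁻¹ give a twisted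
monogenerator, while a global monogenerator would make J principal.

It remains to find d with J nonprincipal when A is not a PID
(`isPrincipalIdealRing_of_square_part`). For a prime P not above 2, choose d₁, d₂ ≡ 1 mod 4 with
P-valuation one and with no other common prime factor. If their square parts are J₁ and J₂, that of
d₁d₂ is PJ₁J₂. If all three are principal, so is P, and the primes not above 2 generate the class
group. -/

/-! ### Square and squarefree parts. -/

section SquarefreePart

variable {M : Type*} [CommMonoidWithZero M]

theorem exists_eq_mul_self_mul_squarefree [UniqueFactorizationMonoid M] {a : M} (ha : a ≠ 0) :
    ∃ b s, a = b * b * s ∧ Squarefree s := by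
  induction a using UniqueFactorizationMonoid.induction_on_prime with
  | h₁ => exact absurd rfl ha
  | h₂ x hx => exact ⟨1, x, by simp, hx.squarefree⟩
  | h₃ a p ha' hp ih =>
    obtain ⟨b, s, rfl, hs⟩ := ih ha'
    by_cases h : p ∣ s
    · obtain ⟨s, rfl⟩ := h
      exact ⟨p * b, s, by ac_rfl, hs.squarefree_of_dvd (Dvd.intro_left p rfl)⟩
    · refine ⟨b, p * s, by ac_rfl, squarefree_mul_iff.2 ⟨?_, hp.squarefree, hs⟩⟩
      exact hp.irreducible.isRelPrime_iff_not_dvd.2 h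

/-- After dividing out the gcd, b'² is prime to a'², hence divides s, so b' is a unit. -/
theorem dvd_of_mul_self_dvd_mul_self_mul_squarefree [GCDMonoid M] {a b s : M}
    (hs : Squarefree s) (h : b * b ∣ a * a * s) : b ∣ a := by
  obtain ⟨a', b', ha, hb, hu⟩ := extract_gcd a b
  by_cases h0 : gcd a b = 0
  · simp [((gcd_eq_zero_iff a b).1 h0).1]
  rw [gcd_isUnit_iff_isRelPrime] at hu
  have h' : b' * b' ∣ a' * a' * s := by
    refine (mul_dvd_mul_iff_left (mul_ne_zero h0 h0)).1 ?_
    calc gcd a b * gcd a b * (b' * b') = b * b := by conv_rhs => rw [hb, mul_mul_mul_comm]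
      _ ∣ a * a * s := h
      _ = gcd a b * gcd a b * (a' * a' * s) := by
        conv_lhs => rw [ha, mul_mul_mul_comm, mul_assoc]
  have hrel : IsRelPrime (b' * b') (a' * a') :=
    (hu.symm.mul_right hu.symm).mul_left (hu.symm.mul_right hu.symm)
  have hb' : IsUnit b' := hs b' (hrel.dvd_of_dvd_mul_left h')
  rw [hb]
  exact (hb'.mul_right_dvd.2 dvd_rfl).trans (gcd_dvd_left a b)

end SquarefreePart

/-! ### Ideal classes and square parts of elements congruent to 1 mod 4. -/

section DedekindDomain

theorem Ideal.isPrincipal_mul {A : Type*} [CommRing A] {I J : Ideal A}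
    (hI : I.IsPrincipal) (hJ : J.IsPrincipal) :
    (I * J).IsPrincipal := by
  obtain ⟨x, rfl⟩ := hI
  obtain ⟨y, rfl⟩ := hJ
  exact ⟨x * y, Ideal.span_singleton_mul_span_singleton x y⟩

variable {A : Type*} [CommRing A] [IsDedekindDomain A]

theorem Ideal.isPrincipal_of_mul_span_singleton {I : Ideal A} {x y : A} (hy : y ≠ 0)
    (h : I * Ideal.span {y} = Ideal.span {x}) : I.IsPrincipal := by
  have hx : x ∈ I * Ideal.span {y} := h ▸ Ideal.mem_span_singleton_self x
  obtain ⟨z, hz, rfl⟩ := Ideal.mem_mul_span_singleton.1 hx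
  refine ⟨z, ?_⟩
  rw [← Ideal.span_singleton_mul_span_singleton] at h
  exact mul_right_cancel₀ (by simpa using hy) h

/-- If the prime ideals prime to `a` are principal, then all ideals are. -/
theorem isPrincipalIdealRing_of_prime_sup_span_eq_top {a : A} (ha : a ≠ 0)
    (H : ∀ P : Ideal A, Prime P → P ⊔ Ideal.span {a} = ⊤ → P.IsPrincipal) :
    IsPrincipalIdealRing A := by
  have key : ∀ I : Ideal A, I ⊔ Ideal.span {a} = ⊤ → I.IsPrincipal := by
    intro I
    induction I using UniqueFactorizationMonoid.induction_on_prime with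
    | h₁ => exact fun _ => ⟨0, by simp⟩
    | h₂ x hx => exact fun _ => ⟨1, by simpa using hx⟩
    | h₃ I P _ hP ih =>
      intro h
      have h1 : P ⊔ Ideal.span {a} = ⊤ :=
        top_le_iff.1 (h ▸ sup_le_sup_right Ideal.mul_le_left _)
      have h2 : I ⊔ Ideal.span {a} = ⊤ :=
        top_le_iff.1 (h ▸ sup_le_sup_right Ideal.mul_le_right _)
      exact Ideal.isPrincipal_mul (H P hP h1) (ih h2)
  refine ⟨fun I => ?_⟩
  by_cases hI : I = ⊥
  · exact hI ▸ ⟨0, by simp⟩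
  have hI' : I * Ideal.span {a} ≠ 0 := mul_ne_zero hI (by simpa using ha)
  -- Here I = I(a) + (x), so (x) = IC with C prime to a: the class of I is inverse to that of C.
  obtain ⟨x, hx⟩ := IsDedekindDomain.exists_sup_span_eq
    (Ideal.mul_le_left : I * Ideal.span {a} ≤ I) hI'
  obtain ⟨C, hC⟩ : I ∣ Ideal.span {x} := Ideal.dvd_iff_le.2 (hx ▸ le_sup_right)
  have hC' : C ⊔ Ideal.span {a} = ⊤ := by
    refine mul_left_cancel₀ hI ?_
    rw [Ideal.mul_sup, ← hC, sup_comm, hx, Ideal.mul_top]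
  -- If x = 0 then C = 0, so a is a unit and `key` applies to I itself.
  by_cases hx0 : x = 0
  · refine key I (top_le_iff.1 (hC' ▸ sup_le ?_ le_sup_right))
    have : C = ⊥ := by
      rw [hx0, Ideal.span_singleton_zero] at hC
      simpa [hI] using hC.symm
    simp [this]
  obtain ⟨c, rfl⟩ := key C hC'
  refine Ideal.isPrincipal_of_mul_span_singleton (x := x) (y := c) ?_ hC.symm
  rintro rfl
  simp [hx0] at hC

/-- Chinese remainder theorem: d ≡ p mod P² for some p in P but not in P², and d ≡ 1 mod M. -/
theorem exists_mem_prime_notMem_sq {P M : Ideal A} (hP : Prime P) (hM : P ⊔ M = ⊤) :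
    ∃ d ∈ P, d ∉ P ^ 2 ∧ d - 1 ∈ M := by
  obtain ⟨p, hp, hp'⟩ := Ideal.exists_mem_pow_notMem_pow_succ P hP.ne_zero
    (fun h => hP.not_isUnit (by simpa using h)) 1
  rw [pow_one] at hp
  have h : IsCoprime (P ^ 2) M := (Ideal.isCoprime_iff_sup_eq.2 hM).pow_left
  obtain ⟨u, hu, v, hv, huv⟩ := Ideal.isCoprime_iff_exists.1 h
  obtain rfl : v = 1 - u := by rw [← huv]; ring
  refine ⟨p * (1 - u) + u, ?_, fun h => hp' ?_, ?_⟩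
  · exact add_mem (Ideal.mul_mem_right _ _ hp) (Ideal.pow_le_self two_ne_zero hu)
  · have : p = p * (1 - u) + u - (1 - p) * u := by ring
    rw [this]
    exact sub_mem h (Ideal.mul_mem_left _ _ hu)
  · have : p * (1 - u) + u - 1 = (p - 1) * (1 - u) := by ring
    rw [this]
    exact Ideal.mul_mem_left _ _ hv

/-- If the square parts of all principal ideals `(d)` with `d ≡ 1 mod 4` are principal, then all
ideals are principal. -/
theorem isPrincipalIdealRing_of_square_part (h2 : (2 : A) ≠ 0)
    (H : ∀ (d : A) (J S : Ideal A), (4 : A) ∣ d - 1 → Squarefree S →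
      Ideal.span {d} = J * J * S → J.IsPrincipal) : IsPrincipalIdealRing A := by
  refine isPrincipalIdealRing_of_prime_sup_span_eq_top h2 fun P hP hP2 => ?_
  have hmax : P.IsMaximal := (Ideal.isPrime_of_prime hP).isMaximal hP.ne_zero
  have h4 : P ⊔ Ideal.span {(4 : A)} = ⊤ := by
    have : (4 : A) = 2 ^ 2 := by norm_num
    rw [this, ← Ideal.span_singleton_pow, ← Ideal.isCoprime_iff_sup_eq]
    exact (Ideal.isCoprime_iff_sup_eq.2 hP2).pow_right
  have sq : ∀ d ∈ P, d ∉ P ^ 2 →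
      ∃ J S, Squarefree S ∧ Squarefree (P * S) ∧ Ideal.span {d} = P * (J * J * S) ∧
        P ⊔ (J * J * S) = ⊤ := by
    intro d hd hd'
    obtain ⟨C, hC⟩ : P ∣ Ideal.span {d} := by simpa [Ideal.dvd_span_singleton] using hd
    have hPC : ¬ P ∣ C := by
      rintro ⟨C, rfl⟩
      apply hd'
      rw [← Ideal.dvd_span_singleton, hC, pow_two, ← mul_assoc]
      exact Dvd.intro _ rfl
    have hC0 : C ≠ 0 := by rintro rfl; simp at hPC
    obtain ⟨J, S, rfl, hS⟩ := exists_eq_mul_self_mul_squarefree hC0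
    refine ⟨J, S, hS, squarefree_mul_iff.2 ⟨?_, hP.squarefree, hS⟩, hC, ?_⟩
    · exact hP.irreducible.isRelPrime_iff_not_dvd.2 fun h => hPC (h.mul_left _)
    · by_contra h
      exact hPC (Ideal.dvd_iff_le.2 (le_sup_right.trans (hmax.eq_of_le h le_sup_left).ge))
  obtain ⟨d₁, hd₁, hd₁', hd₁4⟩ := exists_mem_prime_notMem_sq hP h4
  obtain ⟨J₁, S₁, hS₁, hPS₁, e₁, hc₁⟩ := sq d₁ hd₁ hd₁'
  -- Taking d₂ ≡ 1 modulo J₁²S₁ as well makes S₁ and S₂ coprime, so that S₁S₂ is squarefree.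
  have h4' : P ⊔ Ideal.span {(4 : A)} * (J₁ * J₁ * S₁) = ⊤ := by
    rw [← Ideal.isCoprime_iff_sup_eq] at h4 hc₁ ⊢
    exact h4.mul_right hc₁
  obtain ⟨d₂, hd₂, hd₂', hd₂4⟩ := exists_mem_prime_notMem_sq hP h4'
  obtain ⟨J₂, S₂, hS₂, hPS₂, e₂, -⟩ := sq d₂ hd₂ hd₂'
  have hS : IsRelPrime S₁ S₂ := by
    refine IsCoprime.isRelPrime (Ideal.isCoprime_iff_exists.2 ⟨1 - d₂, ?_, d₂, ?_, by ring⟩)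
    · have := Ideal.mul_le_right (Ideal.mul_le_right hd₂4)
      simpa using neg_mem this
    · have : d₂ ∈ P * (J₂ * J₂ * S₂) := e₂ ▸ Ideal.mem_span_singleton_self d₂
      exact Ideal.mul_le_right (Ideal.mul_le_right this)
  have k₁ : (4 : A) ∣ d₁ - 1 := Ideal.mem_span_singleton.1 hd₁4
  have k₂ : (4 : A) ∣ d₂ - 1 := Ideal.mem_span_singleton.1 (Ideal.mul_le_left hd₂4)
  have p₁ := H d₁ J₁ (P * S₁) k₁ hPS₁ (by rw [e₁]; ac_rfl)
  have p₂ := H d₂ J₂ (P * S₂) k₂ hPS₂ (by rw [e₂]; ac_rfl)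
  have k₃ : (4 : A) ∣ d₁ * d₂ - 1 := by
    have : d₁ * d₂ - 1 = (d₁ - 1) * d₂ + (d₂ - 1) := by ring
    rw [this]
    exact dvd_add (k₁.mul_right _) k₂
  have p₃ := H (d₁ * d₂) (P * (J₁ * J₂)) (S₁ * S₂) k₃ (squarefree_mul_iff.2 ⟨hS, hS₁, hS₂⟩) (by
      rw [← Ideal.span_singleton_mul_span_singleton, e₁, e₂]; ac_rfl)
  obtain ⟨j, hj⟩ := Ideal.isPrincipal_mul p₁ p₂
  obtain ⟨x, hx⟩ := p₃
  refine Ideal.isPrincipal_of_mul_span_singleton (x := x) (y := j) ?_ ((congrArg _ hj.symm).trans hx)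
  rintro rfl
  have h0 : J₁ * J₂ = 0 := by simpa using hj
  rcases mul_eq_zero.1 h0 with rfl | rfl
  · exact hd₁' (by simp at e₁; simp [e₁])
  · exact hd₂' (by simp at e₂; simp [e₂])

end DedekindDomain

/-! ### Twisted monogenerators from invertible ideals. -/

theorem isMonogenerator_one_tmul {A B R : Type*} [CommRing A] [CommRing B] [Algebra A B]
    [CommRing R] [Algebra A R] {f : A} (hf : IsUnit (algebraMap A R f)) {x : B}
    (h : ∀ b : B, ∃ a c : A, f • b = algebraMap A B a + c • x) :
    IsMonogenerator R (1 ⊗ₜ x : R ⊗[A] B) := by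
  rw [IsMonogenerator, ← top_le_iff]
  rintro y -
  induction y using TensorProduct.induction_on with
  | zero => exact zero_mem _
  | add y z hy hz => exact add_mem hy hz
  | tmul r b =>
    obtain ⟨a, c, hac⟩ := h b
    obtain ⟨u, hu⟩ := hf.exists_left_inv
    have key : (r ⊗ₜ b : R ⊗[A] B) = (r * u * algebraMap A R a) • 1 +
        (r * u * algebraMap A R c) • (1 ⊗ₜ x) := by
      have h1 : r = f • (r * u) := by
        rw [Algebra.smul_def, mul_left_comm, mul_comm _ u, hu, mul_one]
      conv_lhs => rw [h1, TensorProduct.smul_tmul, hac, TensorProduct.tmul_add,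
        Algebra.algebraMap_eq_smul_one, ← TensorProduct.smul_tmul, ← TensorProduct.smul_tmul]
      rw [Algebra.TensorProduct.one_def, TensorProduct.smul_tmul', TensorProduct.smul_tmul',
        smul_eq_mul, smul_eq_mul, mul_one, mul_one, Algebra.smul_def, Algebra.smul_def,
        mul_comm (r * u), mul_comm (r * u)]
    rw [key]
    have hx : (1 ⊗ₜ x : R ⊗[A] B) ∈ Algebra.adjoin R {(1 ⊗ₜ x : R ⊗[A] B)} :=
      Algebra.subset_adjoin rfl
    generalize Algebra.adjoin R {(1 ⊗ₜ x : R ⊗[A] B)} = S at hx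
    exact S.add_mem (S.smul_mem S.one_mem (r * u * algebraMap A R a))
      (S.smul_mem hx (r * u * algebraMap A R c))

/-- If `B = A ⊕ φ(N)` for an invertible ideal `N`, then `B` is twisted monogenic over `A`. -/
theorem isTwistedMonogenic_of_mul_eq_span {A : Type u} [CommRing A] [IsDomain A] {B : Type v}
    [CommRing B] [Algebra A B] {J N : Ideal A} {m : A} (hm : m ≠ 0)
    (h : J * N = Ideal.span {m}) (φ : N →ₗ[A] B)
    (hφ : ∀ b, ∃ a n, b = algebraMap A B a + φ n) : IsTwistedMonogenic A B := by
  have hq (g : J) (w : N) : ∃ q, (g : A) * w = m * q :=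
    Ideal.mem_span_singleton.1 (h ▸ Ideal.mul_mem_mul g.2 w.2)
  -- `q g w` is gw/m. The elements `f i` below are these quotients, indexed by all pairs in J × N.
  choose q hq using hq
  have hqq (g g' : J) (w w' : N) : q g w * q g' w' = q g w' * q g' w :=
    mul_left_cancel₀ (mul_ne_zero hm hm) (by
      linear_combination (-m * q g' w') * hq g w - (g : A) * w * hq g' w' +
        (m * q g' w) * hq g w' + (g : A) * w' * hq g' w)
  have hqφ (g : J) (w w' : N) : q g w • φ w' = q g w' • φ w := by
    rw [← map_smul, ← map_smul]
    congr 1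
    ext
    refine mul_left_cancel₀ hm ?_
    simp only [SetLike.val_smul, smul_eq_mul]
    linear_combination (-(w' : A)) * hq g w + (w : A) * hq g w'
  let f (i : J × N) : A := q i.1 i.2
  -- The transition unit is morally wᵢ/wⱼ, written as (gⱼwᵢ/m)/(gⱼwⱼ/m). Its numerator is invertible
  -- because it divides `f i * f j`.
  have hu (i j : J × N) : ∃ u : (Localization.Away (f i * f j))ˣ,
      (u : Localization.Away (f i * f j)) * algebraMap A _ (f j) =
        algebraMap A _ (q j.1 i.2) := by
    have hij : IsUnit (algebraMap A (Localization.Away (f i * f j)) (f i * f j)) :=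
      IsLocalization.Away.algebraMap_isUnit _
    have h1 := isUnit_of_dvd_unit (map_dvd (algebraMap A _) (Dvd.intro_left (f i) rfl)) hij
    have h2 : IsUnit (algebraMap A (Localization.Away (f i * f j)) (q j.1 i.2)) :=
      isUnit_of_dvd_unit (map_dvd (algebraMap A _)
        (Dvd.intro (q i.1 j.2) (by rw [hqq]; exact mul_comm _ _))) hij
    exact ⟨h2.unit * h1.unit⁻¹, by simp [mul_assoc]⟩
  choose u hu using hu
  refine ⟨J × N, ⟨⟨f, ?_, fun i => 1 ⊗ₜ φ i.2, fun i => ?_, u, fun i j => ?_, fun i j k => ?_⟩⟩⟩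
  · rw [PrimeSpectrum.iSup_basicOpen_eq_top_iff]
    have hle : J * N ≤ Ideal.span {m} * Ideal.span (Set.range f) := by
      refine Ideal.mul_le.2 fun g hg w hw => ?_
      rw [hq ⟨g, hg⟩ ⟨w, hw⟩]
      exact Ideal.mul_mem_mul (Ideal.mem_span_singleton_self m)
        (Ideal.subset_span ⟨(⟨g, hg⟩, ⟨w, hw⟩), rfl⟩)
    obtain ⟨z, hz, hmz⟩ := Ideal.mem_span_singleton_mul.1
      (hle (h ▸ Ideal.mem_span_singleton_self m))
    rw [mul_eq_left₀ hm] at hmz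
    exact (Ideal.eq_top_iff_one _).2 (hmz ▸ hz)
  -- By `hqφ`, φ(wᵢ) generates φ(N) once `f i` is inverted.
  · refine isMonogenerator_one_tmul (IsLocalization.Away.algebraMap_isUnit (f i)) fun b => ?_
    obtain ⟨a, n, rfl⟩ := hφ b
    refine ⟨f i * a, q i.1 n, ?_⟩
    rw [smul_add, hqφ, Algebra.smul_def, map_mul]
  · have hij : IsUnit (algebraMap A (Localization.Away (f i * f j)) (f i * f j)) :=
      IsLocalization.Away.algebraMap_isUnit _
    have h1 := isUnit_of_dvd_unit (map_dvd (algebraMap A _) (Dvd.intro_left (f i) rfl)) hij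
    simp only [awayAlgRes, Algebra.TensorProduct.map_tmul, map_one, AlgHom.coe_id, id_eq]
    refine (h1.smul_left_cancel).1 ?_
    rw [smul_smul, mul_comm (algebraMap A (Localization.Away (f i * f j)) (f j)), hu,
      TensorProduct.smul_tmul', TensorProduct.smul_tmul', smul_eq_mul, smul_eq_mul, mul_one, mul_one, Algebra.algebraMap_eq_smul_one,
      Algebra.algebraMap_eq_smul_one, TensorProduct.smul_tmul, TensorProduct.smul_tmul, hqφ]
  · have hijk : IsUnit (algebraMap A (Localization.Away (f i * f j * f k)) (f i * f j * f k)) :=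
      IsLocalization.Away.algebraMap_isUnit _
    have hjk := isUnit_of_dvd_unit (map_dvd (algebraMap A _)
      (Dvd.intro_left (f i) (mul_assoc _ _ _).symm : f j * f k ∣ f i * f j * f k)) hijk
    have e1 := congrArg (awayRes (Dvd.intro (f k) rfl : f i * f j ∣ f i * f j * f k)) (hu i j)
    have e2 := congrArg (awayRes
      (Dvd.intro_left (f i) (mul_assoc _ _ _).symm : f j * f k ∣ f i * f j * f k)) (hu j k)
    have e3 := congrArg (awayRes
      (Dvd.intro (f j) (mul_right_comm _ _ _) : f i * f k ∣ f i * f j * f k)) (hu i k)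
    rw [map_mul, AlgHom.commutes, AlgHom.commutes] at e1 e2 e3
    refine hjk.mul_right_cancel ?_
    have e4 : algebraMap A (Localization.Away (f i * f j * f k)) (q j.1 i.2) *
        algebraMap A _ (q k.1 j.2) = algebraMap A _ (q k.1 i.2) * algebraMap A _ (f j) := by
      rw [← map_mul, ← map_mul, hqq j.1 k.1 i.2 j.2, mul_comm (q k.1 i.2)]
    rw [map_mul, mul_mul_mul_comm, e1, e2, e4, ← e3]
    ring

/-! ### Integers of the quadratic extension. -/

section QuadraticAlgebra

variable {A K : Type*} [CommRing A] [IsDedekindDomain A] [Field K] [Algebra A K]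
  [IsFractionRing A K]

/-- For `d = 1 + 4e` with `(d) = J²S`, `S` squarefree, and `JN = (m)`, the integral elements of
`K[ω]`, `ω² - dω + de = 0`, are those of `A + m⁻¹Nω`. -/
theorem isIntegral_quadraticAlgebra_iff {d e m : A} {J N S : Ideal A} (hd : d - 1 = 4 * e)
    (hS : Squarefree S) (hJ : Ideal.span {d} = J * J * S) (hm : m ≠ 0)
    (hN : J * N = Ideal.span {m})
    (x : QuadraticAlgebra K (-algebraMap A K (d * e)) (algebraMap A K d)) :
    IsIntegral A x ↔
      (∃ a, algebraMap A K a = x.re) ∧ ∃ n ∈ N, algebraMap A K n = algebraMap A K m * x.im := by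
  have hinj : Function.Injective (algebraMap A K) := IsFractionRing.injective A K
  have hm' : algebraMap A K m ≠ 0 := (map_ne_zero_iff _ hinj).2 hm
  have hre (a : A) : IsIntegral A
      (⟨algebraMap A K a, 0⟩ : QuadraticAlgebra K (-algebraMap A K (d * e)) (algebraMap A K d)) :=
    isIntegral_algebraMap (x := a)
  have him (s : K) (n : A) (hn : n ∈ N) (hs : algebraMap A K n = algebraMap A K m * s) :
      IsIntegral A
        (⟨0, s⟩ : QuadraticAlgebra K (-algebraMap A K (d * e)) (algebraMap A K d)) := by
    have hdJ : d ∈ J * J * S := hJ ▸ Ideal.mem_span_singleton_self d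
    -- With s = n/m, the element sω has trace ds = p and norm des² = qe. These lie in A because d ∈
    -- J² and s ∈ J⁻¹.
    obtain ⟨p, hp⟩ : m ∣ d * n := Ideal.mem_span_singleton.1
      (hN ▸ Ideal.mul_mem_mul (Ideal.mul_le_right (Ideal.mul_le_left hdJ)) hn)
    obtain ⟨q, hq⟩ : m * m ∣ d * (n * n) := by
      rw [← Ideal.mem_span_singleton, ← Ideal.span_singleton_mul_span_singleton, ← hN,
        mul_mul_mul_comm]
      exact Ideal.mul_mem_mul (Ideal.mul_le_left hdJ) (Ideal.mul_mem_mul hn hn)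
    have hp' : algebraMap A K p = algebraMap A K d * s := by
      refine mul_left_cancel₀ hm' ?_
      rw [← map_mul, ← hp, map_mul, hs]; ring
    have hq' : algebraMap A K q = algebraMap A K d * (s * s) := by
      refine mul_left_cancel₀ (mul_ne_zero hm' hm') ?_
      rw [← map_mul, ← map_mul, ← hq, map_mul, map_mul, hs, map_mul]; ring
    refine ⟨Polynomial.X ^ 2 - Polynomial.C p * Polynomial.X + Polynomial.C (q * e), ?_, ?_⟩
    · monicity!
    · have hal (a : A) : algebraMap A
          (QuadraticAlgebra K (-algebraMap A K (d * e)) (algebraMap A K d)) a =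
          ⟨algebraMap A K a, 0⟩ := rfl
      simp only [Polynomial.eval₂_add, Polynomial.eval₂_sub,
        Polynomial.eval₂_X, Polynomial.eval₂_mul, Polynomial.eval₂_C, pow_two, hal]
      ext
      · simp [hq']; ring
      · simp [hp']
  have hadd : x = ⟨x.re, 0⟩ + ⟨0, x.im⟩ := by ext <;> simp
  constructor
  · intro hx
    obtain ⟨n, hn, hns⟩ : ∃ n ∈ N, algebraMap A K n = algebraMap A K m * x.im := by
      have hst : IsIntegral A (star x) :=
        hx.map_of_comp_eq (RingHom.id A) (starRingEnd _) (by
          ext a <;> simp [IsScalarTower.algebraMap_apply A K (QuadraticAlgebra _ _ _),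
            starRingEnd_apply])
      have hint : IsIntegral A (algebraMap K
          (QuadraticAlgebra K (-algebraMap A K (d * e)) (algebraMap A K d))
            (algebraMap A K d * x.im ^ 2)) := by
        -- The difference of x and its conjugate is `x.im` times 2ω − d, and (2ω − d)² = d.
        convert (hx.sub hst).mul (hx.sub hst) using 1
        have hd' : algebraMap A K d - 1 = 4 * algebraMap A K e := by
          simpa only [map_sub, map_mul, map_one, map_ofNat] using congrArg (algebraMap A K) hd
        rw [QuadraticAlgebra.algebraMap_eq]
        ext
        · simp
          linear_combination (-(algebraMap A K d * x.im ^ 2)) * hd'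
        · simp
          ring
      rw [isIntegral_algebraMap_iff (FaithfulSMul.algebraMap_injective _ _)] at hint
      obtain ⟨q, hq⟩ := IsIntegrallyClosed.algebraMap_eq_of_integral hint
      obtain ⟨α, β, hβ, hαβ⟩ := IsFractionRing.div_surjective (A := A) x.im
      have hβ0 : β ≠ 0 := nonZeroDivisors.ne_zero hβ
      have hβ' : algebraMap A K β ≠ 0 := (map_ne_zero_iff _ hinj).2 hβ0
      have heq : α * α * d = q * (β * β) := by
        apply hinj
        simp only [map_mul]
        rw [hq, ← hαβ]
        field_simp
      -- Since S is squarefree, d(α/β)² ∈ A forces α/β ∈ J⁻¹ = m⁻¹N.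
      obtain ⟨X, hX⟩ : Ideal.span {β} ∣ Ideal.span {α} * J := by
        refine dvd_of_mul_self_dvd_mul_self_mul_squarefree hS (Dvd.intro_left (Ideal.span {q}) ?_)
        calc Ideal.span {q} * (Ideal.span {β} * Ideal.span {β})
          _ = Ideal.span {α} * Ideal.span {α} * Ideal.span {d} := by
            simp only [Ideal.span_singleton_mul_span_singleton, heq]
          _ = _ := by rw [hJ]; ac_rfl
      have hmem : α * m ∈ Ideal.span {β} * (X * N) := by
        rw [← mul_assoc, ← hX, mul_assoc, hN]
        exact Ideal.mul_mem_mul (Ideal.mem_span_singleton_self _) (Ideal.mem_span_singleton_self _)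
      obtain ⟨n, hn, hn'⟩ := Ideal.mem_span_singleton_mul.1 hmem
      refine ⟨n, Ideal.mul_le_right hn, mul_left_cancel₀ hβ' ?_⟩
      rw [← map_mul, hn', ← hαβ, map_mul]
      field_simp
    refine ⟨?_, n, hn, hns⟩
    have h0 : IsIntegral A (algebraMap K
        (QuadraticAlgebra K (-algebraMap A K (d * e)) (algebraMap A K d)) x.re) := by
      have := hx.sub (him _ n hn hns)
      convert this using 1
      ext <;> simp
    rw [isIntegral_algebraMap_iff (FaithfulSMul.algebraMap_injective _ _)] at h0
    exact IsIntegrallyClosed.algebraMap_eq_of_integral h0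
  · rintro ⟨⟨a, ha⟩, n, hn, hns⟩
    rw [hadd, ← ha]
    exact (hre a).add (him _ n hn hns)

/-- Completing the square, a root makes d = t² with t ∈ A. Then (t)² = J²S forces J = (t). -/
theorem quadraticAlgebra_no_root {d e : A} {J S : Ideal A}
    (hd : d - 1 = 4 * e) (hS : Squarefree S) (hJ : Ideal.span {d} = J * J * S)
    (hprin : ¬ J.IsPrincipal) (r : K) :
    r ^ 2 ≠ -algebraMap A K (d * e) + algebraMap A K d * r := by
  intro hr
  have hs : (2 * r - algebraMap A K d) ^ 2 = algebraMap A K d := by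
    have hd' : algebraMap A K d - 1 = 4 * algebraMap A K e := by
      simpa only [map_sub, map_mul, map_one, map_ofNat] using congrArg (algebraMap A K) hd
    rw [map_mul] at hr
    linear_combination 4 * hr + algebraMap A K d * hd'
  have hint : IsIntegral A (2 * r - algebraMap A K d) :=
    IsIntegral.of_pow two_pos (by rw [hs]; exact isIntegral_algebraMap)
  obtain ⟨t, ht⟩ := IsIntegrallyClosed.algebraMap_eq_of_integral hint
  rw [← ht, ← map_pow] at hs
  have hsq : t ^ 2 = d := IsFractionRing.injective A K hs
  have hT : Ideal.span {t} * Ideal.span {t} = J * J * S := by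
    rw [Ideal.span_singleton_mul_span_singleton, ← pow_two, hsq, hJ]
  have h1 : Ideal.span {t} ∣ J := dvd_of_mul_self_dvd_mul_self_mul_squarefree hS (dvd_of_eq hT)
  have h2 : J ∣ Ideal.span {t} := by
    refine dvd_of_mul_self_dvd_mul_self_mul_squarefree squarefree_one ?_
    rw [mul_one, hT]
    exact Dvd.intro _ rfl
  exact hprin ⟨t, dvd_antisymm h2 h1⟩

end QuadraticAlgebra

/-- If `d ≡ 1 mod 4` has nonprincipal square part, then the ring of integers of `K(√d)` is
twisted monogenic but not monogenic over that of `K`. -/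
theorem exists_isTwistedMonogenic_not_isMonogenic (K : Type u) [Field K] [NumberField K]
    {d : 𝓞 K} {J S : Ideal (𝓞 K)} (hd : 4 ∣ d - 1) (hS : Squarefree S)
    (hJ : Ideal.span {d} = J * J * S) (hprin : ¬ J.IsPrincipal) :
    ∃ (L : Type u) (_ : Field L) (_ : NumberField L) (_ : Algebra K L),
      IsTwistedMonogenic (𝓞 K) (𝓞 L) ∧ ¬ IsMonogenic (𝓞 K) (𝓞 L) := by
  obtain ⟨e, he⟩ := hd
  have hJ0 : J ≠ ⊥ := by rintro rfl; exact hprin inferInstance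
  obtain ⟨m, hmJ, hm⟩ := Submodule.exists_mem_ne_zero_of_ne_bot hJ0
  obtain ⟨N, hN⟩ : J ∣ Ideal.span {m} := Ideal.dvd_span_singleton.2 hmJ
  have : Fact (∀ r : K, r ^ 2 ≠ -algebraMap (𝓞 K) K (d * e) + algebraMap (𝓞 K) K d * r) :=
    ⟨quadraticAlgebra_no_root he hS hJ hprin⟩
  let L := QuadraticAlgebra K (-algebraMap (𝓞 K) K (d * e)) (algebraMap (𝓞 K) K d)
  have : NumberField L :=
    { to_charZero := inferInstance
      to_finiteDimensional := Module.Finite.trans (R := ℚ) K L }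
  have hm' : algebraMap (𝓞 K) K m ≠ 0 :=
    (map_ne_zero_iff _ NumberField.RingOfIntegers.coe_injective).2 hm
  have hint (x : L) : IsIntegral ℤ x ↔ (∃ a, algebraMap (𝓞 K) K a = x.re) ∧
      ∃ n ∈ N, algebraMap (𝓞 K) K n = algebraMap (𝓞 K) K m * x.im := by
    rw [← isIntegral_quadraticAlgebra_iff he hS hJ hm hN.symm x]
    exact ⟨fun h => h.tower_top, fun h => isIntegral_trans (R := ℤ) x h⟩
  let φ : N →ₗ[𝓞 K] 𝓞 L :=
    { toFun n := ⟨⟨0, algebraMap (𝓞 K) K n / algebraMap (𝓞 K) K m⟩,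
        (hint _).2 ⟨⟨0, map_zero _⟩, n, n.2, (mul_div_cancel₀ _ hm').symm⟩⟩
      map_add' n n' := by
        refine NumberField.RingOfIntegers.ext ?_
        change (⟨0, _⟩ : L) = ⟨0, _⟩ + ⟨0, _⟩
        ext <;> simp [add_div]
      map_smul' a n := by
        refine NumberField.RingOfIntegers.ext ?_
        refine Eq.trans ?_ (congrArg (fun z : 𝓞 L => (z : L)) (Algebra.smul_def a _).symm)
        change (⟨0, _⟩ : L) = ⟨algebraMap (𝓞 K) K a, 0⟩ * ⟨0, _⟩
        ext <;> simp [mul_div_assoc] }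
  refine ⟨L, inferInstance, inferInstance, inferInstance, ?_, ?_⟩
  · refine isTwistedMonogenic_of_mul_eq_span hm hN.symm φ fun b => ?_
    obtain ⟨⟨a, ha⟩, n, hn, hns⟩ := (hint b).1 b.2
    refine ⟨a, ⟨n, hn⟩, NumberField.RingOfIntegers.ext ?_⟩
    change (b : L) = ⟨algebraMap (𝓞 K) K a, 0⟩ +
      ⟨0, algebraMap (𝓞 K) K n / algebraMap (𝓞 K) K m⟩
    rw [ha, hns, mul_div_cancel_left₀ _ hm']
    exact QuadraticAlgebra.ext (add_zero _).symm (zero_add _).symm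
  · rintro ⟨x, hx⟩
    obtain ⟨-, n₀, hn₀, hns₀⟩ := (hint x).1 x.2
    obtain ⟨p, hp⟩ : m ∣ d * n₀ := by
      have hdJ : d ∈ J * J * S := hJ ▸ Ideal.mem_span_singleton_self d
      exact Ideal.mem_span_singleton.1
        (hN ▸ Ideal.mul_mem_mul (Ideal.mul_le_right (Ideal.mul_le_left hdJ)) hn₀)
    have hp' : algebraMap (𝓞 K) K p = algebraMap (𝓞 K) K d * (x : L).im := by
      refine mul_left_cancel₀ hm' ?_
      rw [← map_mul, ← hp, map_mul, hns₀]; ring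
    -- The ω-coordinates of A[x] lie in A · `x.im`. In products the extra term d·`y.im`·`z.im` is
    -- harmless since d·`x.im` = p ∈ A. Hence N is generated by n₀.
    have him (y : 𝓞 L) : ∃ s, (y : L).im = algebraMap (𝓞 K) K s * (x : L).im := by
      have hy : y ∈ Algebra.adjoin (𝓞 K) {x} := by rw [hx]; trivial
      induction hy using Algebra.adjoin_induction with
      | mem y hy => exact ⟨1, by rw [Set.mem_singleton_iff.1 hy]; simp⟩
      | algebraMap r => exact ⟨0, by rw [map_zero, zero_mul]; rfl⟩
      | add y z _ _ hy hz =>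
        obtain ⟨s, hs⟩ := hy
        obtain ⟨t, ht⟩ := hz
        refine ⟨s + t, ?_⟩
        change (y : L).im + (z : L).im = _
        rw [hs, ht, map_add, add_mul]
      | mul y z _ _ hy hz =>
        obtain ⟨s, hs⟩ := hy
        obtain ⟨t, ht⟩ := hz
        obtain ⟨⟨a, ha⟩, -⟩ := (hint y).1 y.2
        obtain ⟨⟨b, hb⟩, -⟩ := (hint z).1 z.2
        refine ⟨a * t + s * b + s * t * p, ?_⟩
        change ((y : L) * (z : L)).im = _
        rw [QuadraticAlgebra.im_mul, hs, ht, ← ha, ← hb]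
        simp only [map_add, map_mul, hp']
        ring
    have hNn : N = Ideal.span {n₀} := by
      refine le_antisymm (fun n hn => ?_) ((Ideal.span_singleton_le_iff_mem _).2 hn₀)
      obtain ⟨s, hs⟩ := him (φ ⟨n, hn⟩)
      change algebraMap (𝓞 K) K n / algebraMap (𝓞 K) K m = _ at hs
      refine Ideal.mem_span_singleton'.2 ⟨s, NumberField.RingOfIntegers.coe_injective ?_⟩
      rw [div_eq_iff hm', mul_assoc, mul_comm (x : L).im, ← hns₀, ← map_mul] at hs
      exact hs.symm
    refine hprin (Ideal.isPrincipal_of_mul_span_singleton (x := m) (y := n₀) ?_ (hNn ▸ hN.symm))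
    rintro rfl
    rw [hNn] at hN
    exact hm (by simpa using hN)

/-! ### Triviality of the cocycle over a PID. -/

section PrincipalIdealRing

variable {A K : Type*} [CommRing A] [IsDomain A] [Field K] [Algebra A K] [IsFractionRing A K]

/-- In a PID, a family `c i` of nonzero elements of the fraction field whose ratios `c i / c j` are
regular where `f i` and `f j` are invertible is, up to a common factor, a family of units of
the rings `A[1 / f i]`. -/
theorem exists_forall_div_mem_away [IsPrincipalIdealRing A] {ι : Type*} [Finite ι] (i₀ : ι)
    {f : ι → A} (hf : ∀ i, f i ≠ 0) {c : ι → K} (hc : ∀ i, c i ≠ 0)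
    (h : ∀ i j, ∃ (n : ℕ) (a : A), (f i * f j) ^ n • (c i / c j) = algebraMap A K a) :
    ∃ z : K, z ≠ 0 ∧ ∀ i, (∃ (n : ℕ) (a : A), f i ^ n • (z / c i) = algebraMap A K a) ∧
      ∃ (n : ℕ) (a : A), f i ^ n • (c i / z) = algebraMap A K a := by
  have hinj : Function.Injective (algebraMap A K) := IsFractionRing.injective A K
  have hf' (i) : algebraMap A K (f i) ≠ 0 := (map_ne_zero_iff _ hinj).2 (hf i)
  obtain ⟨N, hN⟩ : ∃ N : ℕ, ∀ i j, ∃ a : A, (f i * f j) ^ N • (c i / c j) = algebraMap A K a := by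
    choose n a ha using h
    obtain ⟨N, hN⟩ := Finite.exists_le fun p : ι × ι => n p.1 p.2
    refine ⟨N, fun i j => ⟨(f i * f j) ^ (N - n i j) * a i j, ?_⟩⟩
    rw [map_mul, ← ha, ← Algebra.smul_def, smul_smul, ← pow_add, Nat.sub_add_cancel (hN (i, j))]
  choose a ha using hN
  let b (j : ι) : K := c j * algebraMap A K (f i₀) ^ N / c i₀
  have hb (j : ι) : b j ≠ 0 := div_ne_zero (mul_ne_zero (hc j) (pow_ne_zero _ (hf' i₀))) (hc i₀)
  -- I consists of the x ∈ A lying in every b j · A[1/f j]. The scaling of b makes f j ^ N · b j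
  -- equal to `a j i₀`, an element of I, so a generator of I differs from b j by a unit of A[1/f j].
  let I : Ideal A :=
    { carrier := {x | ∀ j, ∃ (n : ℕ) (y : A),
        f j ^ n • (algebraMap A K x / b j) = algebraMap A K y}
      zero_mem' := fun j => ⟨0, 0, by simp⟩
      add_mem' := by
        intro x y hx hy j
        obtain ⟨n, x', hx'⟩ := hx j
        obtain ⟨m, y', hy'⟩ := hy j
        refine ⟨n + m, f j ^ m * x' + f j ^ n * y', ?_⟩
        simp only [Algebra.smul_def, map_add, map_mul] at hx' hy' ⊢
        rw [← hx', ← hy', pow_add, map_mul]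
        ring
      smul_mem' := by
        intro r x hx j
        obtain ⟨n, x', hx'⟩ := hx j
        refine ⟨n, r * x', ?_⟩
        rw [smul_eq_mul, map_mul, map_mul, ← hx', Algebra.smul_def, Algebra.smul_def]
        ring }
  have haI (j : ι) : a j i₀ ∈ I := by
    intro k
    refine ⟨N, a j k, ?_⟩
    rw [← ha, ← ha]
    simp only [Algebra.smul_def, map_mul, map_pow, b]
    have := hc i₀
    have := hc k
    have := hf' i₀
    rw [mul_pow, mul_pow]
    field_simp
  obtain ⟨g, hg⟩ := IsPrincipalIdealRing.principal I
  have hgI : g ∈ I := hg ▸ Ideal.mem_span_singleton_self g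
  have hdvd (j : ι) : g ∣ a j i₀ := by
    have := haI j
    rwa [hg, Ideal.submodule_span_eq, Ideal.mem_span_singleton] at this
  have hg0 : g ≠ 0 := by
    rintro rfl
    have h0 := ha i₀ i₀
    rw [zero_dvd_iff.1 (hdvd i₀), map_zero, div_self (hc i₀), Algebra.smul_def, mul_one] at h0
    exact pow_ne_zero N (mul_ne_zero (hf i₀) (hf i₀)) (hinj (h0.trans (map_zero _).symm))
  have hg' : algebraMap A K g ≠ 0 := (map_ne_zero_iff _ hinj).2 hg0
  refine ⟨algebraMap A K g * c i₀ / algebraMap A K (f i₀) ^ N,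
    div_ne_zero (mul_ne_zero hg' (hc i₀)) (pow_ne_zero _ (hf' i₀)), fun j => ⟨?_, ?_⟩⟩
  · obtain ⟨n, y, hy⟩ := hgI j
    refine ⟨n, y, ?_⟩
    rw [← hy]
    congr 1
    have := hc i₀
    have := hc j
    have := hf' i₀
    simp only [b]
    field_simp
  · obtain ⟨s, hs⟩ := hdvd j
    refine ⟨N, s, mul_left_cancel₀ hg' ?_⟩
    rw [← map_mul, ← hs, ← ha, Algebra.smul_def, Algebra.smul_def, map_pow, map_pow, map_mul,
      mul_pow]
    have := hc i₀
    have := hf' i₀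
    field_simp

end PrincipalIdealRing

/-! ### Comparing localizations inside K and L. -/

section AwayMaps

variable {A : Type u} [CommRing A] {B : Type v} [CommRing B] [Algebra A B] (K : Type*) [Field K]
  [Algebra A K] [FaithfulSMul A K] (L : Type*) [Field L] [Algebra A L] [Algebra B L] [Algebra K L]
  [IsScalarTower A B L] [IsScalarTower A K L]

/-- The inclusion of `A[1/f]` in a field containing `A`. -/
noncomputable def awayToField {f : A} (hf : f ≠ 0) : Localization.Away f →ₐ[A] K :=
  IsLocalization.liftAlgHom (M := Submonoid.powers f) (f := Algebra.ofId A K) (by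
    rintro ⟨_, n, rfl⟩
    rw [map_pow]
    exact (((map_ne_zero_iff _ (FaithfulSMul.algebraMap_injective A K)).2 hf).isUnit).pow n)

/-- The map `B[1/f] → L` to a field containing `B`. -/
noncomputable def awayAlgToField {f : A} (hf : f ≠ 0) : AwayAlg B f →ₐ[A] L :=
  Algebra.TensorProduct.lift ((IsScalarTower.toAlgHom A K L).comp (awayToField K hf))
    (IsScalarTower.toAlgHom A B L) (fun _ _ => Commute.all _ _)

variable {L}

theorem awayToField_awayRes {f g : A} (hf : f ≠ 0) (hg : g ≠ 0) (h : f ∣ g)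
    (x : Localization.Away f) : awayToField K hg (awayRes h x) = awayToField K hf x := by
  have := IsLocalization.algHom_subsingleton (R := A) (S := Localization.Away f) (P := K)
    (Submonoid.powers f)
  exact congrArg (fun φ : Localization.Away f →ₐ[A] K => φ x)
    (Subsingleton.elim ((awayToField K hg).comp (awayRes h)) (awayToField K hf))

theorem awayAlgToField_tmul {f : A} (hf : f ≠ 0) (r : Localization.Away f) (b : B) :
    awayAlgToField K L hf (r ⊗ₜ b) = algebraMap K L (awayToField K hf r) * algebraMap B L b :=
  Algebra.TensorProduct.lift_tmul ..

theorem awayAlgToField_smul {f : A} (hf : f ≠ 0) (r : Localization.Away f) (x : AwayAlg B f) :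
    awayAlgToField K L hf (r • x) =
      algebraMap K L (awayToField K hf r) * awayAlgToField K L hf x := by
  induction x using TensorProduct.induction_on with
  | zero => simp
  | add x y hx hy => rw [smul_add, map_add, hx, hy, map_add, mul_add]
  | tmul s b =>
    rw [TensorProduct.smul_tmul', awayAlgToField_tmul, awayAlgToField_tmul, smul_eq_mul, map_mul,
      map_mul, mul_assoc]

theorem awayAlgToField_awayAlgRes {f g : A} (hf : f ≠ 0) (hg : g ≠ 0) (h : f ∣ g)
    (x : AwayAlg B f) :
    awayAlgToField K L hg (awayAlgRes B h x) = awayAlgToField K L hf x := by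
  induction x using TensorProduct.induction_on with
  | zero => simp
  | add x y hx hy => rw [map_add, map_add, hx, hy, map_add]
  | tmul s b =>
    rw [awayAlgRes, Algebra.TensorProduct.map_tmul, awayAlgToField_tmul, awayAlgToField_tmul,
      awayToField_awayRes K hf]
    rfl

theorem exists_pow_smul_awayToField {f : A} (hf : f ≠ 0) (x : Localization.Away f) :
    ∃ (n : ℕ) (a : A), f ^ n • awayToField K hf x = algebraMap A K a := by
  obtain ⟨⟨a, _, n, rfl⟩, h⟩ := IsLocalization.surj (Submonoid.powers f) x
  refine ⟨n, a, ?_⟩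
  rw [← (awayToField K hf).commutes, ← h, map_mul, AlgHom.commutes, Algebra.smul_def, mul_comm]

theorem exists_pow_smul_awayAlgToField {f : A} (hf : f ≠ 0) (x : AwayAlg B f) :
    ∃ (n : ℕ) (b : B), f ^ n • awayAlgToField K L hf x = algebraMap B L b := by
  induction x using TensorProduct.induction_on with
  | zero => exact ⟨0, 0, by simp⟩
  | add x y hx hy =>
    obtain ⟨n, x', hx'⟩ := hx
    obtain ⟨m, y', hy'⟩ := hy
    refine ⟨n + m, f ^ m • x' + f ^ n • y', ?_⟩
    rw [map_add, map_add, algebraMap.smul (A := A) (B := B) (C := L),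
      algebraMap.smul (A := A) (B := B) (C := L), ← hx', ← hy', smul_smul,
      smul_smul, ← pow_add, ← pow_add, smul_add, add_comm m]
  | tmul r b =>
    obtain ⟨n, a, ha⟩ := exists_pow_smul_awayToField K hf r
    refine ⟨n, a • b, ?_⟩
    rw [awayAlgToField_tmul, ← smul_mul_assoc, ← algebraMap.smul (A := A) (B := K) (C := L), ha,
      ← IsScalarTower.algebraMap_apply, ← Algebra.smul_def, algebraMap.smul (A := A) (B := B) (C := L)]

end AwayMaps

/-- Both τ ∈ B and B ⊆ A[τ] are membership statements for A-submodules of L, so they can be checked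
after multiplying by powers of the `f i`. -/
theorem isMonogenic_of_forall_away {A : Type u} [CommRing A] [IsDomain A] {B : Type v} [CommRing B]
    [Algebra A B] (K : Type*) [Field K] [Algebra A K] [IsFractionRing A K]
    {L : Type*} [Field L] [Algebra A L] [Algebra B L] [Algebra K L]
    [IsScalarTower A B L] [IsScalarTower A K L]
    {ι : Type*} {f : ι → A} (hf : ∀ i, f i ≠ 0)
    (hspan : Ideal.span (Set.range f) = ⊤) (hBL : Function.Injective (algebraMap B L))
    {θ : ∀ i, AwayAlg B (f i)} (hθ : ∀ i, IsMonogenerator (Localization.Away (f i)) (θ i))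
    {τ : L} {c : ι → K} (hc : ∀ i, c i ≠ 0)
    (hτ : ∀ i, algebraMap K L (c i) * awayAlgToField K L (hf i) (θ i) = τ)
    (h₁ : ∀ i, ∃ (n : ℕ) (a : A), f i ^ n • c i = algebraMap A K a)
    (h₂ : ∀ i, ∃ (n : ℕ) (a : A), f i ^ n • (c i)⁻¹ = algebraMap A K a) :
    IsMonogenic A B := by
  obtain ⟨t, rfl⟩ : τ ∈ LinearMap.range (IsScalarTower.toAlgHom A B L).toLinearMap := by
    refine Submodule.mem_of_span_eq_top_of_smul_pow_mem _ _ hspan _ ?_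
    rintro ⟨_, i, rfl⟩
    obtain ⟨n, a, ha⟩ := h₁ i
    obtain ⟨m, b, hb⟩ := exists_pow_smul_awayAlgToField K (L := L) (hf i) (θ i)
    refine ⟨n + m, a • b, ?_⟩
    change algebraMap B L (a • b) = f i ^ (n + m) • τ
    rw [algebraMap.smul (A := A) (B := B) (C := L), ← hb, ← algebraMap_smul K a, ← ha, ← hτ i, pow_add,
      Algebra.smul_def (f i ^ n • c i), algebraMap.smul (A := A) (B := K) (C := L), smul_mul_smul_comm]
  change ∀ i, _ = algebraMap B L t at hτ
  refine ⟨t, top_le_iff.1 fun b _ => ?_⟩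
  suffices hb : algebraMap B L b ∈ Algebra.adjoin A {algebraMap B L t} by
    have := AlgHom.map_adjoin_singleton (IsScalarTower.toAlgHom A B L) t
    rw [IsScalarTower.coe_toAlgHom'] at this
    rw [← this] at hb
    obtain ⟨b', hb', h⟩ := hb
    exact hBL h ▸ hb'
  refine Submodule.mem_of_span_eq_top_of_smul_pow_mem
    (Subalgebra.toSubmodule (Algebra.adjoin A {algebraMap B L t})) _ hspan _ ?_
  rintro ⟨_, i, rfl⟩
  generalize hS : Algebra.adjoin A {algebraMap B L t} = S
  have htS : algebraMap B L t ∈ S := hS ▸ Algebra.subset_adjoin rfl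
  have key (x : AwayAlg B (f i)) : ∃ n : ℕ, f i ^ n • awayAlgToField K L (hf i) x ∈ S := by
    have hx : x ∈ Algebra.adjoin (Localization.Away (f i)) {θ i} := by
      rw [hθ i]; exact Algebra.mem_top
    induction hx using Algebra.adjoin_induction with
    | mem y hy =>
      obtain ⟨n, a, ha⟩ := h₂ i
      refine ⟨n, ?_⟩
      have : f i ^ n • awayAlgToField K L (hf i) y = a • algebraMap B L t := by
        rw [Set.mem_singleton_iff.1 hy, ← hτ i, ← algebraMap_smul K a, ← ha,
          Algebra.smul_def (f i ^ n • (c i)⁻¹),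
          algebraMap.smul (A := A) (B := K) (C := L), smul_mul_assoc,
          ← mul_assoc, ← map_mul, inv_mul_cancel₀ (hc i), map_one, one_mul]
      rw [this]
      exact S.smul_mem htS a
    | algebraMap r =>
      obtain ⟨n, a, ha⟩ := exists_pow_smul_awayToField K (hf i) r
      refine ⟨n, ?_⟩
      rw [Algebra.algebraMap_eq_smul_one, awayAlgToField_smul, map_one, mul_one,
        ← algebraMap.smul (A := A) (B := K) (C := L), ha, ← IsScalarTower.algebraMap_apply]
      exact S.algebraMap_mem a
    | add y z _ _ hy hz =>
      obtain ⟨n, hn⟩ := hy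
      obtain ⟨m, hm⟩ := hz
      refine ⟨m + n, ?_⟩
      rw [map_add, smul_add]
      refine S.add_mem ?_ ?_
      · rw [pow_add, mul_smul]
        exact S.smul_mem hn _
      · rw [add_comm, pow_add, mul_smul]
        exact S.smul_mem hm _
    | mul y z _ _ hy hz =>
      obtain ⟨n, hn⟩ := hy
      obtain ⟨m, hm⟩ := hz
      refine ⟨n + m, ?_⟩
      rw [map_mul, pow_add, ← smul_mul_smul_comm]
      exact S.mul_mem hn hm
  obtain ⟨n, hn⟩ := key (1 ⊗ₜ b)
  rw [awayAlgToField_tmul, map_one, map_one, one_mul] at hn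
  exact ⟨n, hn⟩

/-- Twisted monogenic extensions of a PID are monogenic. -/
theorem IsTwistedMonogenic.isMonogenic {A : Type u} [CommRing A] [IsDomain A] [IsPrincipalIdealRing A]
    {B : Type v} [CommRing B] [Algebra A B] (K : Type*) [Field K] [Algebra A K] [IsFractionRing A K]
    {L : Type*} [Field L] [Algebra A L] [Algebra B L] [Algebra K L]
    [IsScalarTower A B L] [IsScalarTower A K L]
    (hBL : Function.Injective (algebraMap B L))
    (h : IsTwistedMonogenic A B) : IsMonogenic A B := by
  obtain ⟨ι, ⟨T⟩⟩ := h
  obtain ⟨s, hsT, hs⟩ := (Ideal.span_eq_top_iff_finite _).1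
    ((PrimeSpectrum.iSup_basicOpen_eq_top_iff).1 T.cover)
  -- Finiteness gives a uniform exponent later. Zero is discarded because A[1/0] has no map to K.
  have hj (x : {x : A // x ∈ s ∧ x ≠ 0}) : ∃ i, T.f i = x := hsT x.2.1
  choose j hj using hj
  have hf (x) : T.f (j x) ≠ 0 := by rw [hj]; exact x.2.2
  have hspan : Ideal.span (Set.range fun x => T.f (j x)) = ⊤ := by
    rw [← top_le_iff, ← hs, Ideal.span_le]
    intro x hx
    by_cases hx0 : x = 0
    · rw [hx0]; exact zero_mem _
    · exact Ideal.subset_span ⟨⟨x, hx, hx0⟩, hj _⟩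
  have : Finite {x : A // x ∈ s ∧ x ≠ 0} := Finite.of_injective
    (fun x => (⟨x.1, x.2.1⟩ : s)) fun x y h => Subtype.ext (congrArg (fun z : s => (z : A)) h)
  obtain ⟨i₀⟩ : Nonempty {x : A // x ∈ s ∧ x ≠ 0} := by
    by_contra h
    rw [not_nonempty_iff] at h
    rw [Set.range_eq_empty, Ideal.span_empty] at hspan
    exact bot_ne_top hspan
  have hff (x y) : T.f (j x) * T.f (j y) ≠ 0 := mul_ne_zero (hf x) (hf y)
  let c (x y) : K := awayToField K (hff x y) (T.a (j x) (j y))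
  have hc (x y) : c x y ≠ 0 := ((T.a (j x) (j y)).isUnit.map (awayToField K (hff x y))).ne_zero
  have hcoc (x y z) : c x y * c y z = c x z := by
    have := congrArg (awayToField K (mul_ne_zero (hff x y) (hf z))) (T.cocycle (j x) (j y) (j z))
    rwa [map_mul, awayToField_awayRes K (hff x y), awayToField_awayRes K (hff y z),
      awayToField_awayRes K (hff x z)] at this
  have hsmul (x y) : algebraMap K L (c x y) * awayAlgToField K L (hf y) (T.θ (j y)) =
      awayAlgToField K L (hf x) (T.θ (j x)) := by
    have := congrArg (awayAlgToField K L (hff x y)) (T.smul_eq (j x) (j y))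
    rwa [awayAlgToField_smul, awayAlgToField_awayAlgRes K (hf y),
      awayAlgToField_awayAlgRes K (hf x)] at this
  -- By the cocycle relation, the ratio `c i₀ x / c i₀ y` is `c y x`, regular where both `f`s are
  -- invertible.
  obtain ⟨z, hz, h⟩ := exists_forall_div_mem_away (K := K) i₀ hf (hc i₀) fun x y => by
    rw [← hcoc i₀ y x, mul_div_cancel_left₀ _ (hc i₀ y), mul_comm (T.f (j x))]
    exact exists_pow_smul_awayToField K (hff y x) _
  refine isMonogenic_of_forall_away K hf hspan hBL (fun x => T.isMonogenerator (j x))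
    (τ := algebraMap K L z⁻¹ * awayAlgToField K L (hf i₀) (T.θ (j i₀)))
    (c := fun x => c i₀ x / z) (fun x => div_ne_zero (hc i₀ x) hz) (fun x => ?_)
    (fun x => (h x).2) (fun x => ?_)
  · rw [← hsmul i₀ x, ← mul_assoc, ← map_mul, div_eq_inv_mul]
  · rw [inv_div]
    exact (h x).1

theorem mainTheorem7 (K : Type u) [Field K] [NumberField K] :
    NumberField.classNumber K = 1 ↔
      ∀ (L : Type u) [Field L] [NumberField L] [Algebra K L],
        IsTwistedMonogenic (𝓞 K) (𝓞 L) → IsMonogenic (𝓞 K) (𝓞 L) := by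
  rw [NumberField.classNumber_eq_one_iff]
  constructor
  · intro _ L _ _ _ h
    exact IsTwistedMonogenic.isMonogenic K (L := L) NumberField.RingOfIntegers.coe_injective h
  · intro H
    refine isPrincipalIdealRing_of_square_part two_ne_zero fun d J S hd hS hJ => ?_
    by_contra hprin
    obtain ⟨L, _, _, _, h, h'⟩ := exists_isTwistedMonogenic_not_isMonogenic K hd hS hJ hprin
    exact h' (H L h)
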